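/- Let $\mathbb{N}=\{0,1,2,\dots\}$ and let $k\ge 1$. Define a well-ordering $\prec_{\mathbb{N}}$ on $\mathbb{N}^k$ by recursion on $k$. On $\mathbb{N}^1$ it is the usual order $0<1<2<\cdots$. For $k>1$ and $u=(u_1,\dots,u_k)\in\mathbb{N}^k$ put $M(u)=\max_i u_i$ and $i_u=\min\{i : u_i=M(u)\}$, and let $u'\in\mathbb{N}^{k-1}$ be obtained from $u$ by deleting its $i_u$-th coordinate. For $u\ne v$ in $\mathbb{N}^k$ set $u\prec_{\mathbb{N}} v$ if and only if one of the following holds: (a) $M(u)<M(v)$; (b) $M(u)=M(v)$ and $i_v<i_u$; (c) $M(u)=M(v)$, $i_u=i_v$ and $u'\prec_{\mathbb{N}}v'$ in $\mathbb{N}^{k-1}$. A finite set $S\subset\mathbb{N}^k$ is an initial segment if $v\in S$ and $u\prec_{\mathbb{N}}v$ imply $u\in S$. For $I\subseteq\{1,\dots,k\}$ and finite $Y\subset\mathbb{N}^k$, let $P_I(Y)$ denote the projection of $Y$ which results from deletion of the coordinates in $I$. For $n\in\mathbb{N}$ let $Y_n$ denote the set of all subsets $Y\subset\mathbb{N}^k$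 of size $n$, and define $f:Y_n\to\mathbb{R}$ by $$f(Y)=\sum_{I\subseteq\{1,\dots,k\}}|P_I(Y)|.$$ Then there is exactly one initial segment of $\mathbb{N}^k$ of size $n$ with respect to $\prec_{\mathbb{N}}$, and $f$ attains its minimum over $Y_n$ at it. -/

import Mathlib

/-- `M(u)`: the largest entry of a vector `u` with at least one coordinate. -/
def maxEntry {k : ℕ} (u : Fin (k + 1) → ℕ) : ℕ :=
  Finset.univ.sup' Finset.univ_nonempty u

theorem exists_eq_maxEntry {k : ℕ} (u : Fin (k + 1) → ℕ) :
    (Finset.univ.filter fun i => u i = maxEntry u).Nonempty := by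
  obtain ⟨i, -, hi⟩ := Finset.exists_mem_eq_sup' Finset.univ_nonempty u
  exact ⟨i, Finset.mem_filter.2 ⟨Finset.mem_univ i, hi.symm⟩⟩

/-- `i_u = min {i : u_i = M(u)}`: the first position at which the largest entry occurs. -/
def firstMax {k : ℕ} (u : Fin (k + 1) → ℕ) : Fin (k + 1) :=
  (Finset.univ.filter fun i => u i = maxEntry u).min' (exists_eq_maxEntry u)

/-- The well-ordering `u ≺ v` on `ℕ^k`. On `ℕ^1` it is the usual order. For larger `k`, compare
first the largest entries; then the first positions of the largest entry (the vector whose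
position is further to the right is the smaller one); then, recursively, the vectors obtained by
deleting that common position. (`ℕ^0` has a single point, so the relation is empty there.) -/
def PrecN : (k : ℕ) → (Fin k → ℕ) → (Fin k → ℕ) → Prop
  | 0, _, _ => False
  | 1, u, v => u 0 < v 0
  | k + 2, u, v =>
      maxEntry u < maxEntry v ∨
      (maxEntry u = maxEntry v ∧ firstMax v < firstMax u) ∨
      (maxEntry u = maxEntry v ∧ firstMax u = firstMax v ∧
        PrecN (k + 1) ((firstMax u).removeNth u) ((firstMax v).removeNth v))

/-- A finite set is an initial segment of `(ℕ^k, ≺)` if it is closed under taking predecessors. -/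
def IsInitialSegmentN {k : ℕ} (S : Finset (Fin k → ℕ)) : Prop :=
  ∀ v ∈ S, ∀ u : Fin k → ℕ, PrecN k u v → u ∈ S

/-- `P_I(Y)`: the projection of `Y` which deletes the coordinates in `I`. -/
def deleteCoords {k : ℕ} (I : Finset (Fin k)) (Y : Finset (Fin k → ℕ)) :
    Finset ({i : Fin k // i ∉ I} → ℕ) :=
  Y.image fun y i => y i.1

/-- `f(Y) = ∑_{I ⊆ [k]} |P_I(Y)|`. -/
def projectionSum {k : ℕ} (Y : Finset (Fin k → ℕ)) : ℝ :=
  ∑ I : Finset (Fin k), ((deleteCoords I Y).card : ℝ)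

/-! Write `h k n` for the projection sum of the initial segment of size `n` in dimension `k`.
Initial segments grow through boxes with all sides `r` or `r + 1`: between consecutive boxes, one
enlarges a side and fills the new layer by an initial segment of one dimension less. The layer adds
only the projections that keep its fixed coordinate, so `h (k + 1) (B + t) = h (k + 1) B + h k t`
for a box size `B` and a partial layer of size `t` (`LayerRecursion`).

Minimality goes by induction on the dimension and on `n = |Y|`. Choose the direction in which `Y`
takes the most values, say `s`; then `n ≤ s ^ (k + 1)`, and some layer has size `m` with `m * s ≤
n`. Cutting it off lowers the projection sum by at least that of the layer, so induction leaves the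
numerical inequality `h (k + 1) n ≤ h (k + 1) (n - m) + h k m` (`RemovesLayer`).

That inequality follows from the recursion, the subadditivity of `h k` (`segmentCount_add_le`), and
concavity at box sizes (`BoxConcave`), with one recursive appeal to itself a dimension lower
(`removesLayer`). -/

/-! ### Arithmetic of box sizes -/

/-- The number of points of a box in `ℕ^k` with `k - j` sides of length `r` and `j` sides of
length `r + 1`. -/
def boxCard (k r j : ℕ) : ℕ := r ^ (k - j) * (r + 1) ^ j

theorem boxCard_zero_right (k r : ℕ) : boxCard k r 0 = r ^ k := by simp [boxCard]

theorem boxCard_self (k r : ℕ) : boxCard k r k = boxCard k (r + 1) 0 := by simp [boxCard]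

theorem boxCard_add (k r j : ℕ) (hj : j ≤ k) :
    boxCard (k + 1) r j + boxCard k r j = boxCard (k + 1) r (j + 1) := by
  have h1 : k + 1 - j = (k - j) + 1 := by omega
  have h2 : k + 1 - (j + 1) = k - j := by omega
  simp only [boxCard, h1, h2]
  ring

theorem boxCard_succ_succ (k r j : ℕ) :
    boxCard (k + 1) r (j + 1) = (r + 1) * boxCard k r j := by
  have h2 : k + 1 - (j + 1) = k - j := by omega
  simp only [boxCard, h2]
  ring

theorem boxCard_pos (k r j : ℕ) (hr : 1 ≤ r) : 1 ≤ boxCard k r j :=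
  Nat.mul_pos (Nat.pow_pos hr) (Nat.pow_pos (Nat.succ_pos r))

theorem pow_le_boxCard (k r j : ℕ) (hj : j ≤ k) : r ^ k ≤ boxCard k r j := by
  obtain ⟨i, rfl⟩ := Nat.exists_eq_add_of_le hj
  simp only [boxCard, Nat.add_sub_cancel_left]
  rw [add_comm j i, pow_add]
  exact Nat.mul_le_mul_left _ (Nat.pow_le_pow_left (Nat.le_succ r) j)

theorem boxCard_le_pow (k r j : ℕ) (hj : j ≤ k) : boxCard k r j ≤ (r + 1) ^ k := by
  obtain ⟨i, rfl⟩ := Nat.exists_eq_add_of_le hj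
  simp only [boxCard, Nat.add_sub_cancel_left]
  rw [add_comm j i, pow_add]
  exact Nat.mul_le_mul_right _ (Nat.pow_le_pow_left (Nat.le_succ r) i)

theorem boxCard_mono_right (k r : ℕ) {i j : ℕ} (hij : i ≤ j) (hj : j ≤ k) :
    boxCard k r i ≤ boxCard k r j := by
  obtain ⟨d, rfl⟩ := Nat.exists_eq_add_of_le hij
  have h : k - i = (k - (i + d)) + d := by omega
  simp only [boxCard, h]
  rw [pow_add, pow_add, mul_assoc, mul_comm (r ^ d)]
  exact Nat.mul_le_mul_left _ (Nat.mul_le_mul_left _ (Nat.pow_le_pow_left (Nat.le_succ r) d))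

theorem boxCard_le_boxCard (k r s : ℕ) {i j : ℕ} (hi : i ≤ k) (hj : j ≤ k)
    (h : r < s ∨ r = s ∧ i ≤ j) : boxCard k r i ≤ boxCard k s j := by
  rcases h with h | ⟨rfl, h⟩
  · exact (boxCard_le_pow k r i hi).trans
      ((Nat.pow_le_pow_left h k).trans (pow_le_boxCard k s j hj))
  · exact boxCard_mono_right k r h hj

/-- Every `n ≥ 2` is obtained from a box by adding a nonempty part of the next layer. -/
theorem exists_eq_boxCard_add (k n : ℕ) (hn : 2 ≤ n) : ∃ r j t, 1 ≤ r ∧ j ≤ k ∧ 1 ≤ t ∧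
    t ≤ boxCard k r j ∧ n = boxCard (k + 1) r j + t := by
  induction n, hn using Nat.le_induction with
  | base =>
    exact ⟨1, 0, 1, le_rfl, Nat.zero_le _, le_rfl, by simp [boxCard], by simp [boxCard]⟩
  | succ n hn ih =>
    obtain ⟨r, j, t, hr, hj, ht, htb, rfl⟩ := ih
    by_cases h : t < boxCard k r j
    · exact ⟨r, j, t + 1, hr, hj, by omega, h, by omega⟩
    have he : t = boxCard k r j := by omega
    rcases Nat.lt_or_ge j k with hjk | hjk
    · exact ⟨r, j + 1, 1, hr, hjk, le_rfl, boxCard_pos _ _ _ hr, by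
        rw [he, boxCard_add k r j hj]⟩
    · have hjk : j = k := by omega
      subst hjk
      exact ⟨r + 1, 0, 1, by omega, Nat.zero_le _, le_rfl, boxCard_pos _ _ _ (by omega), by
        rw [he, boxCard_add j r j hj, boxCard_self]⟩

/-- A box with at least two points arises from a smaller box by adding a full layer. -/
theorem boxCard_eq_one_or (k r j : ℕ) (hr : 1 ≤ r) (hj : j ≤ k + 1) :
    boxCard (k + 1) r j = 1 ∨ ∃ r' j', 1 ≤ r' ∧ j' ≤ k ∧
      boxCard (k + 1) r j = boxCard (k + 1) r' (j' + 1) := by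
  rcases j with _ | j
  · rcases Nat.lt_or_ge r 2 with h | h
    · left
      have : r = 1 := by omega
      simp [boxCard, this]
    · obtain ⟨s, rfl⟩ : ∃ s, r = s + 1 := ⟨r - 1, by omega⟩
      exact Or.inr ⟨s, k, by omega, le_rfl, (boxCard_self (k + 1) s).symm⟩
  · exact Or.inr ⟨r, j, hr, by omega, rfl⟩

/-- If a box is smaller than the top of the layer `(s, j)`, then its own next layer is
not larger than that layer. -/
theorem boxCard_layer_le (k r s : ℕ) {i j : ℕ} (hi : i ≤ k) (hj : j ≤ k)
    (h : boxCard (k + 1) r i < boxCard (k + 1) s (j + 1)) : boxCard k r i ≤ boxCard k s j := by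
  apply boxCard_le_boxCard k r s hi hj
  by_contra hc
  have : boxCard (k + 1) s (j + 1) ≤ boxCard (k + 1) r i :=
    boxCard_le_boxCard (k + 1) s r (by omega) (by omega) (by omega)
  omega

/-! ### Numerical consequences of the layer recursion -/

/-- The recursion satisfied by the projection sums of initial segments. -/
structure LayerRecursion (h : ℕ → ℕ → ℕ) : Prop where
  zero : ∀ k, h k 0 = 0
  one : ∀ k, h k 1 = 2 ^ k
  layer : ∀ k r j t, 1 ≤ r → j ≤ k → t ≤ boxCard k r j →
    h (k + 1) (boxCard (k + 1) r j + t) = h (k + 1) (boxCard (k + 1) r j) + h k t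

namespace LayerRecursion

variable {h : ℕ → ℕ → ℕ}

/-- Splitting off the last layer costs exactly `h k t` in dimension `k + 1`, and by subadditivity at
most that in dimension `k`. -/
theorem le_succ (H : LayerRecursion h) (k : ℕ) (hs : ∀ a b, h k (a + b) ≤ h k a + h k b)
    (n : ℕ) : h k n ≤ h (k + 1) n := by
  induction n using Nat.strong_induction_on with
  | _ n ih =>
    rcases Nat.lt_or_ge n 2 with hn | hn
    · interval_cases n
      · simp [H.zero]
      · rw [H.one, H.one]
        exact Nat.pow_le_pow_right (by norm_num) (Nat.le_succ k)
    · obtain ⟨r, j, t, hr, hj, ht, htb, rfl⟩ := exists_eq_boxCard_add k n hn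
      rw [H.layer k r j t hr hj htb]
      have h1 := ih (boxCard (k + 1) r j) (by omega)
      have h2 := hs (boxCard (k + 1) r j) t
      omega

/-- Local concavity at boxes: among the intervals of given length below a box, the topmost
one has the least weight. -/
def BoxConcave (h : ℕ → ℕ → ℕ) (k : ℕ) : Prop :=
  ∀ r j t d, 1 ≤ r → j ≤ k → t + d ≤ boxCard k r j →
    h k (boxCard k r j) + h k t ≤ h k (t + d) + h k (boxCard k r j - d)

/-- Compares the last `d` points of a full layer with any interval of length `d` below the top of
the box it completes. The interval is cut from above at box sizes until it fits into one layer or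
starts at `0`. -/
theorem top_layer_le (H : LayerRecursion h) (k : ℕ) (hs : ∀ a b, h k (a + b) ≤ h k a + h k b)
    (hE : BoxConcave h k) (r j : ℕ) (hr : 1 ≤ r) (hj : j ≤ k) (t d : ℕ)
    (hd : d ≤ boxCard k r j) (htd : t + d ≤ boxCard (k + 1) r (j + 1)) :
    h k (boxCard k r j) + h (k + 1) t ≤ h (k + 1) (t + d) + h k (boxCard k r j - d) := by
  induction d using Nat.strong_induction_on with
  | _ d ih =>
    rcases Nat.eq_zero_or_pos d with rfl | hd0
    · simp [add_comm]
    rcases Nat.eq_zero_or_pos t with rfl | ht0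
    · have h1 := hs d (boxCard k r j - d)
      rw [Nat.add_sub_cancel' hd] at h1
      have h2 := H.le_succ k hs d
      rw [H.zero, Nat.zero_add]
      omega
    obtain ⟨s, i, y, hs1, hi, hy, hyb, heq⟩ := exists_eq_boxCard_add k (t + d) (by omega)
    have hle : boxCard k s i ≤ boxCard k r j := boxCard_layer_le k s r hi hj (by omega)
    rw [heq, H.layer k s i y hs1 hi hyb]
    rcases Nat.lt_or_ge t (boxCard (k + 1) s i) with hlt | hge
    -- The interval crosses a box size: its top `y` points are handled by subadditivity, the rest by
    -- induction.
    · have h1 := ih (boxCard (k + 1) s i - t) (by omega) (by omega) (by omega)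
      rw [Nat.add_sub_cancel' hlt.le] at h1
      have h2 := hs y (boxCard k r j - d)
      rw [show y + (boxCard k r j - d) = boxCard k r j - (boxCard (k + 1) s i - t) by omega] at h2
      omega
    · obtain ⟨a, rfl⟩ := Nat.exists_eq_add_of_le hge
      have hy' : y = a + d := by omega
      subst hy'
      rw [H.layer k s i a hs1 hi (by omega)]
      have h1 := hE r j a d hr hj (by omega)
      omega

theorem boxConcave_zero (h : ℕ → ℕ → ℕ) : BoxConcave h 0 := by
  intro r j t d _ hj htd
  have hj : j = 0 := by omega
  subst hj
  simp only [boxCard_zero_right, pow_zero] at htd ⊢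
  rcases Nat.eq_zero_or_pos d with rfl | hd
  · simp [add_comm]
  · have h1 : d = 1 := by omega
    have h2 : t = 0 := by omega
    subst h1 h2
    simp

/-- Induction along boxes. An interval no longer than the last layer reduces to `top_layer_le`;
longer ones are reduced to this case. -/
theorem boxConcave_succ (H : LayerRecursion h) (k : ℕ)
    (hs : ∀ a b, h k (a + b) ≤ h k a + h k b) (hE : BoxConcave h k) :
    BoxConcave h (k + 1) := by
  suffices hq : ∀ q r j, 1 ≤ r → j ≤ k + 1 → boxCard (k + 1) r j = q → ∀ t d, t + d ≤ q →
      h (k + 1) q + h (k + 1) t ≤ h (k + 1) (t + d) + h (k + 1) (q - d) by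
    intro r j t d hr hj htd
    exact hq _ r j hr hj rfl t d htd
  intro q
  induction q using Nat.strong_induction_on with
  | _ q ih =>
    intro r j hr hj hq t d htd
    rcases boxCard_eq_one_or k r j hr hj with h1 | ⟨r', j', hr', hj', h1⟩
    · have hq1 : q = 1 := by omega
      subst hq1
      rcases Nat.eq_zero_or_pos d with rfl | hd
      · simp [add_comm]
      · have h1 : d = 1 := by omega
        have h2 : t = 0 := by omega
        subst h1 h2
        simp
    have hadd := boxCard_add k r' j' hj'
    have hpos := boxCard_pos k r' j' hr'
    have small : ∀ t d, d ≤ boxCard k r' j' → t + d ≤ q →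
        h (k + 1) q + h (k + 1) t ≤ h (k + 1) (t + d) + h (k + 1) (q - d) := by
      intro t d hd htd
      have h2 := H.top_layer_le k hs hE r' j' hr' hj' t d hd (by omega)
      have h3 := H.layer k r' j' (boxCard k r' j') hr' hj' le_rfl
      have h4 := H.layer k r' j' (boxCard k r' j' - d) hr' hj' (Nat.sub_le _ _)
      rw [show boxCard (k + 1) r' j' + boxCard k r' j' = q by omega] at h3
      rw [show boxCard (k + 1) r' j' + (boxCard k r' j' - d) = q - d by omega] at h4
      omega
    rcases Nat.lt_or_ge (boxCard k r' j') d with hd | hd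
    · rcases Nat.lt_or_ge (boxCard (k + 1) r' j') (t + d) with hlt | hge
      -- The inequality is symmetric in `t + d` and `q - d`; after swapping them the length `q - d -
      -- t` is less than the last layer.
      · have h2 := small t (q - d - t) (by omega) (by omega)
        rw [show t + (q - d - t) = q - d by omega, show q - (q - d - t) = t + d by omega] at h2
        omega
      -- The interval lies below the previous box: its top part is matched with the last layer, the
      -- remainder with the top of the previous box.
      · have h2 := ih (boxCard (k + 1) r' j') (by omega) r' j' hr' (by omega) rfl t
          (d - boxCard k r' j') (by omega)
        have h3 := small (t + (d - boxCard k r' j')) (boxCard k r' j') le_rfl (by omega)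
        rw [show boxCard (k + 1) r' j' - (d - boxCard k r' j') = q - d by omega] at h2
        rw [show t + (d - boxCard k r' j') + boxCard k r' j' = t + d by omega,
          show q - boxCard k r' j' = boxCard (k + 1) r' j' by omega] at h3
        omega
    · exact small t d hd htd

/-- Removing a layer of at most average size: the inequality driving the main induction. -/
def RemovesLayer (h : ℕ → ℕ → ℕ) (k : ℕ) : Prop :=
  ∀ n s m, 2 ≤ n → n ≤ s ^ (k + 1) → m * s ≤ n → h (k + 1) n ≤ h (k + 1) (n - m) + h k m

/-- When `m` exceeds the partial layer `t`, the removal eats `m - t` points into the last full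
layer. Cancelling what lies below that layer leaves the inequality `hh` in dimension `k`. -/
theorem removesLayer_of_box (H : LayerRecursion h) (k : ℕ) (r j t m : ℕ) (hr : 1 ≤ r)
    (hj : j ≤ k) (hm : t < m) (hmt : m - t ≤ boxCard k r j)
    (hh : h k (boxCard k r j) + h k t ≤ h k m + h k (boxCard k r j - (m - t)))
    (hlayer : h (k + 1) (boxCard (k + 1) r (j + 1) + t) =
      h (k + 1) (boxCard (k + 1) r (j + 1)) + h k t) :
    h (k + 1) (boxCard (k + 1) r (j + 1) + t) ≤
      h (k + 1) (boxCard (k + 1) r (j + 1) + t - m) + h k m := by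
  have h3 := H.layer k r j (boxCard k r j) hr hj le_rfl
  have h4 := H.layer k r j (boxCard k r j - (m - t)) hr hj (Nat.sub_le _ _)
  have hadd := boxCard_add k r j hj
  rw [hadd] at h3
  rw [show boxCard (k + 1) r j + (boxCard k r j - (m - t)) =
    boxCard (k + 1) r (j + 1) + t - m by omega] at h4
  omega

theorem removesLayer (H : LayerRecursion h) (k : ℕ)
    (hs : ∀ a b, h k (a + b) ≤ h k a + h k b) (hE : BoxConcave h k)
    (hK : ∀ l, k = l + 1 → RemovesLayer h l) : RemovesLayer h k := by
  intro n s m hn hns hms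
  obtain ⟨r, j, t, hr, hj, ht, htb, rfl⟩ := exists_eq_boxCard_add k n hn
  have hrs : r + 1 ≤ s := by
    by_contra hc
    have h1 : s ^ (k + 1) ≤ r ^ (k + 1) := Nat.pow_le_pow_left (by omega) _
    have h2 := pow_le_boxCard (k + 1) r j (by omega)
    omega
  have hm : m * (r + 1) ≤ boxCard (k + 1) r j + t := (Nat.mul_le_mul_left m hrs).trans hms
  have hlayer := H.layer k r j t hr hj htb
  rcases Nat.lt_or_ge t m with htm | htm
  swap
  -- The removed points all lie in the partial layer, so subadditivity suffices.
  · have h1 := H.layer k r j (t - m) hr hj (by omega)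
    have h2 := hs (t - m) m
    rw [show t - m + m = t by omega] at h2
    rw [show boxCard (k + 1) r j + (t - m) = boxCard (k + 1) r j + t - m by omega] at h1
    omega
  rcases j with _ | i
  · rw [boxCard_zero_right] at htb
    have hmq : m ≤ r ^ k := by
      rw [boxCard_zero_right, pow_succ] at hm
      by_contra hc
      have : (r ^ k + 1) * (r + 1) ≤ m * (r + 1) := Nat.mul_le_mul_right _ (by omega)
      nlinarith
    rcases Nat.lt_or_ge r 2 with h1 | h2
    · have : r = 1 := by omega
      subst this
      simp only [one_pow] at hmq
      omega
    -- The cube of side `p + 1` is completed by the layer `(p, k)`, which has `(p + 1) ^ k ≥ m`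
    -- points, so concavity applies there.
    obtain ⟨p, rfl⟩ : ∃ p, r = p + 1 := ⟨r - 1, by omega⟩
    have hq : boxCard k p k = (p + 1) ^ k := by rw [boxCard_self, boxCard_zero_right]
    rw [← boxCard_self] at hlayer ⊢
    refine H.removesLayer_of_box k p k t m (by omega) le_rfl htm (by omega) ?_ hlayer
    have := hE p k t (m - t) (by omega) le_rfl (by omega)
    rwa [show t + (m - t) = m by omega] at this
  · have hb := boxCard_succ_succ k r i
    have hmq : (m - boxCard k r i) * (r + 1) ≤ t := by
      rw [Nat.sub_mul]
      have : boxCard k r i * (r + 1) = boxCard (k + 1) r (i + 1) := by rw [hb, mul_comm]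
      omega
    have hmq' : m - boxCard k r i ≤ t :=
      (Nat.le_mul_of_pos_right _ (Nat.succ_pos r)).trans hmq
    refine H.removesLayer_of_box k r i t m hr (by omega) htm (by omega) ?_ hlayer
    rcases Nat.lt_or_ge (boxCard k r i) m with hlt | hge
    -- Here `m` exceeds the last full layer by `e`, and `e * (r + 1) ≤ t`: this is the same removal
    -- problem for `t` one dimension lower, with `s = r + 1`.
    · obtain ⟨l, rfl⟩ : ∃ l, k = l + 1 := ⟨k - 1, by omega⟩
      obtain ⟨e, rfl⟩ := Nat.exists_eq_add_of_le hlt.le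
      rw [Nat.add_sub_cancel_left] at hmq hmq'
      rw [boxCard_succ_succ] at htb
      have he : e ≤ boxCard l r i := by
        have : (r + 1) * e ≤ (r + 1) * boxCard l r i := by linarith [mul_comm e (r + 1)]
        exact Nat.le_of_mul_le_mul_left this (Nat.succ_pos r)
      have ht2 : 2 ≤ t := by nlinarith
      have h1 := hK l rfl t (r + 1) e ht2
        (by
          have := boxCard_le_pow (l + 1) r (i + 1) (by omega)
          rw [boxCard_succ_succ] at this
          omega) hmq
      have h2 := H.layer l r i e hr (by omega) he
      rw [show boxCard (l + 1) r i - (boxCard (l + 1) r i + e - t) = t - e by omega]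
      omega
    · have := hE r i t (m - t) hr (by omega) (by omega)
      rwa [show t + (m - t) = m by omega] at this

end LayerRecursion

/-! ### The order and uniqueness of initial segments -/

theorem le_maxEntry {k : ℕ} (u : Fin (k + 1) → ℕ) (i : Fin (k + 1)) : u i ≤ maxEntry u :=
  Finset.le_sup' u (Finset.mem_univ i)

theorem maxEntry_le {k : ℕ} {u : Fin (k + 1) → ℕ} {m : ℕ} (h : ∀ i, u i ≤ m) :
    maxEntry u ≤ m :=
  Finset.sup'_le _ _ fun i _ => h i

theorem apply_firstMax {k : ℕ} (u : Fin (k + 1) → ℕ) : u (firstMax u) = maxEntry u :=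
  (Finset.mem_filter.1 (Finset.min'_mem _ (exists_eq_maxEntry u))).2

theorem firstMax_le {k : ℕ} {u : Fin (k + 1) → ℕ} {i : Fin (k + 1)} (h : u i = maxEntry u) :
    firstMax u ≤ i :=
  Finset.min'_le _ _ (Finset.mem_filter.2 ⟨Finset.mem_univ i, h⟩)

theorem lt_maxEntry_of_lt_firstMax {k : ℕ} {u : Fin (k + 1) → ℕ} {i : Fin (k + 1)}
    (h : i < firstMax u) : u i < maxEntry u :=
  lt_of_le_of_ne (le_maxEntry u i) fun he => absurd (firstMax_le he) (not_le.2 h)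

theorem precN_succ_iff (k : ℕ) (u v : Fin (k + 1) → ℕ) :
    PrecN (k + 1) u v ↔ maxEntry u < maxEntry v ∨
      (maxEntry u = maxEntry v ∧ firstMax v < firstMax u) ∨
      (maxEntry u = maxEntry v ∧ firstMax u = firstMax v ∧
        PrecN k ((firstMax u).removeNth u) ((firstMax v).removeNth v)) := by
  cases k with
  | succ k => exact Iff.rfl
  | zero =>
    have h0 : ∀ w : Fin 1 → ℕ, firstMax w = 0 := fun w => Fin.fin_one_eq_zero _
    have h : ∀ w : Fin 1 → ℕ, maxEntry w = w 0 := fun w => by rw [← apply_firstMax w, h0 w]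
    simp only [PrecN, h, h0, lt_irrefl, and_false, or_false]

theorem precN_trichotomous (k : ℕ) (u v : Fin k → ℕ) : PrecN k u v ∨ u = v ∨ PrecN k v u := by
  induction k with
  | zero => exact Or.inr (Or.inl (Subsingleton.elim u v))
  | succ k ih =>
    simp only [precN_succ_iff]
    rcases lt_trichotomy (maxEntry u) (maxEntry v) with hM | hM | hM
    · exact Or.inl (Or.inl hM)
    · rcases lt_trichotomy (firstMax u) (firstMax v) with hi | hi | hi
      · exact Or.inr (Or.inr (Or.inr (Or.inl ⟨hM.symm, hi⟩)))
      · rcases ih ((firstMax u).removeNth u) ((firstMax v).removeNth v) with h | h | h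
        · exact Or.inl (Or.inr (Or.inr ⟨hM, hi, h⟩))
        · refine Or.inr (Or.inl ?_)
          rw [← Fin.insertNth_self_removeNth (firstMax u) u,
            ← Fin.insertNth_self_removeNth (firstMax v) v, h, apply_firstMax u, apply_firstMax v,
            hM, hi]
        · exact Or.inr (Or.inr (Or.inr (Or.inr ⟨hM.symm, hi.symm, h⟩)))
      · exact Or.inl (Or.inr (Or.inl ⟨hM, hi⟩))
    · exact Or.inr (Or.inr (Or.inl hM))

namespace IsInitialSegmentN

theorem subset_or_subset {k : ℕ} {S T : Finset (Fin k → ℕ)} (hS : IsInitialSegmentN S)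
    (hT : IsInitialSegmentN T) : S ⊆ T ∨ T ⊆ S := by
  by_contra! hc
  obtain ⟨u, huS, huT⟩ := Finset.not_subset.1 hc.1
  obtain ⟨v, hvT, hvS⟩ := Finset.not_subset.1 hc.2
  rcases precN_trichotomous k u v with h | h | h
  · exact huT (hT v hvT u h)
  · exact huT (h ▸ hvT)
  · exact hvS (hS u huS v h)

theorem subset_of_card_le {k : ℕ} {S T : Finset (Fin k → ℕ)} (hS : IsInitialSegmentN S)
    (hT : IsInitialSegmentN T) (h : S.card ≤ T.card) : S ⊆ T := by
  rcases hS.subset_or_subset hT with h1 | h1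
  · exact h1
  · exact (Finset.eq_of_subset_of_card_le h1 h).ge

theorem eq_of_card_eq {k : ℕ} {S T : Finset (Fin k → ℕ)} (hS : IsInitialSegmentN S)
    (hT : IsInitialSegmentN T) (h : S.card = T.card) : S = T :=
  (hS.subset_of_card_le hT h.le).antisymm (hT.subset_of_card_le hS h.ge)

end IsInitialSegmentN

/-! ### Boxes, layers and existence of initial segments -/

/-- The box whose last `j` sides have length `r + 1` and whose other sides have length `r`. -/
def gridBox (k r j : ℕ) : Finset (Fin k → ℕ) :=
  Fintype.piFinset fun i => Finset.range (if (i : ℕ) < k - j then r else r + 1)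

theorem mem_gridBox {k r j : ℕ} {u : Fin k → ℕ} :
    u ∈ gridBox k r j ↔ ∀ i, u i ≤ r ∧ ((i : ℕ) < k - j → u i < r) := by
  simp only [gridBox, Fintype.mem_piFinset, Finset.mem_range]
  refine forall_congr' fun i => ?_
  split_ifs <;> omega

theorem card_gridBox (k r j : ℕ) (hj : j ≤ k) : (gridBox k r j).card = boxCard k r j := by
  rw [gridBox, Fintype.card_piFinset, boxCard]
  simp only [Finset.card_range]
  rw [Fin.prod_univ_eq_prod_range (fun i => if i < k - j then r else r + 1) k,
    ← Finset.prod_range_mul_prod_Ico _ (Nat.sub_le k j)]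
  congr 1
  · rw [Finset.prod_congr rfl fun i hi => if_pos (Finset.mem_range.1 hi)]
    simp
  · rw [Finset.prod_congr rfl fun i hi => if_neg (not_lt.2 (Finset.mem_Ico.1 hi).1)]
    simp [Nat.sub_sub_self hj]

theorem mem_gridBox_of_maxEntry_le {k r j : ℕ} {u : Fin (k + 1) → ℕ} (hM : maxEntry u ≤ r)
    (h : maxEntry u < r ∨ k + 1 - j ≤ (firstMax u : ℕ)) : u ∈ gridBox (k + 1) r j := by
  refine mem_gridBox.2 fun i => ⟨(le_maxEntry u i).trans hM, fun hi => ?_⟩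
  rcases h with h | h
  · exact (le_maxEntry u i).trans_lt h
  · exact (lt_maxEntry_of_lt_firstMax (Fin.lt_def.2 (hi.trans_le h))).trans_le hM

theorem isInitialSegmentN_gridBox (k r j : ℕ) : IsInitialSegmentN (gridBox k r j) := by
  cases k with
  | zero =>
    intro v hv u h
    exact h.elim
  | succ k =>
    intro v hv u huv
    rw [mem_gridBox] at hv
    have hvM : maxEntry v ≤ r := maxEntry_le fun i => (hv i).1
    rw [precN_succ_iff] at huv
    have hle : maxEntry u ≤ maxEntry v := by rcases huv with h | ⟨h, _⟩ | ⟨h, _⟩ <;> omega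
    refine mem_gridBox_of_maxEntry_le (hle.trans hvM) ?_
    by_contra! hc
    have hi : firstMax v ≤ firstMax u := by
      rcases huv with h | ⟨_, h⟩ | ⟨_, h, _⟩
      · omega
      · exact h.le
      · exact h.ge
    have h1 := (hv (firstMax v)).2 (lt_of_le_of_lt hi hc.2)
    rw [apply_firstMax v] at h1
    omega

/-- The layer which carries `S ⊆ ℕ^k` at height `r` in the coordinate `i`. -/
def layer {k : ℕ} (i : Fin (k + 1)) (r : ℕ) (S : Finset (Fin k → ℕ)) :
    Finset (Fin (k + 1) → ℕ) :=
  S.image (i.insertNth (α := fun _ => ℕ) r)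

theorem card_layer {k : ℕ} (i : Fin (k + 1)) (r : ℕ) (S : Finset (Fin k → ℕ)) :
    (layer i r S).card = S.card :=
  Finset.card_image_of_injective _ (Fin.insertNth_right_injective (α := fun _ => ℕ) r)

theorem mem_layer {k : ℕ} {i : Fin (k + 1)} {r : ℕ} {S : Finset (Fin k → ℕ)}
    {u : Fin (k + 1) → ℕ} : u ∈ layer i r S ↔ u i = r ∧ i.removeNth u ∈ S := by
  simp only [layer, Finset.mem_image]
  constructor
  · rintro ⟨s, hs, rfl⟩
    simpa using hs
  · rintro ⟨rfl, h⟩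
    exact ⟨_, h, Fin.insertNth_self_removeNth i u⟩

/-- The coordinate in which the box `gridBox (k + 1) r j` grows next. -/
def growCoord (k j : ℕ) : Fin (k + 1) := ⟨k - j, by omega⟩

theorem gridBox_growCoord_lt {k r j : ℕ} (hj : j ≤ k) {u : Fin (k + 1) → ℕ}
    (hu : u ∈ gridBox (k + 1) r j) : u (growCoord k j) < r :=
  (mem_gridBox.1 hu _).2 (by simp only [growCoord]; omega)

theorem disjoint_gridBox_layer {k r j : ℕ} (hj : j ≤ k) (S : Finset (Fin k → ℕ)) :
    Disjoint (gridBox (k + 1) r j) (layer (growCoord k j) r S) := by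
  refine Finset.disjoint_left.2 fun u hu hl => ?_
  have h1 := gridBox_growCoord_lt hj hu
  have h2 := (mem_layer.1 hl).1
  omega

theorem removeNth_le_and_lt {k r j : ℕ} {u : Fin (k + 1) → ℕ}
    (h : (growCoord k j).removeNth u ∈ gridBox k r j) (i : Fin (k + 1)) (hi : i ≠ growCoord k j) :
    u i ≤ r ∧ ((i : ℕ) < k - j → u i < r) := by
  obtain ⟨l, rfl⟩ := Fin.exists_succAbove_eq hi
  have h1 := mem_gridBox.1 h l
  simp only [Fin.removeNth] at h1
  refine ⟨h1.1, fun hl => h1.2 ?_⟩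
  rcases Nat.lt_or_ge (l : ℕ) (k - j) with h2 | h2
  · exact h2
  · rw [Fin.succAbove_of_le_castSucc _ _ (Fin.le_def.2 h2)] at hl
    simp only [Fin.val_succ] at hl
    omega

/-- Each point of the new layer has largest entry `r`, first attained at `growCoord k j`.
Predecessors with a smaller maximum or a later first maximum lie in the box; the others are governed
by the order on `S`. -/
theorem isInitialSegmentN_gridBox_union_layer {k r j : ℕ} (hj : j ≤ k)
    {S : Finset (Fin k → ℕ)} (hS : IsInitialSegmentN S) (hSb : S ⊆ gridBox k r j) :
    IsInitialSegmentN (gridBox (k + 1) r j ∪ layer (growCoord k j) r S) := by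
  intro v hv u huv
  rcases Finset.mem_union.1 hv with hv | hv
  · exact Finset.mem_union_left _ (isInitialSegmentN_gridBox _ _ _ v hv u huv)
  obtain ⟨hvr, hvS⟩ := mem_layer.1 hv
  have hvb := removeNth_le_and_lt (hSb hvS)
  have hvM : maxEntry v = r := by
    refine le_antisymm (maxEntry_le fun i => ?_) (hvr ▸ le_maxEntry v _)
    by_cases hi : i = growCoord k j
    · rw [hi, hvr]
    · exact (hvb i hi).1
  have hvi : firstMax v = growCoord k j := by
    refine le_antisymm (firstMax_le (hvr.trans hvM.symm)) ?_
    by_contra! hc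
    have h1 := (hvb _ hc.ne).2 hc
    rw [apply_firstMax v] at h1
    omega
  rw [precN_succ_iff, hvM, hvi] at huv
  rcases huv with h | ⟨hM, hi⟩ | ⟨hM, hi, h⟩
  · exact Finset.mem_union_left _ (mem_gridBox_of_maxEntry_le h.le (Or.inl h))
  · refine Finset.mem_union_left _ (mem_gridBox_of_maxEntry_le hM.le (Or.inr ?_))
    have : k - j < (firstMax u : ℕ) := hi
    omega
  · refine Finset.mem_union_right _ (mem_layer.2 ⟨?_, ?_⟩)
    · rw [← hi, apply_firstMax u, hM]
    · rw [hi] at h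
      exact hS _ hvS _ h

theorem exists_isInitialSegmentN (k n : ℕ) (hn : n ≤ 1 ∨ 1 ≤ k) :
    ∃ S : Finset (Fin k → ℕ), S.card = n ∧ IsInitialSegmentN S := by
  induction k generalizing n with
  | zero =>
    rcases Nat.eq_zero_or_pos n with rfl | h
    · exact ⟨∅, rfl, fun v hv => absurd hv (Finset.notMem_empty v)⟩
    · refine ⟨Finset.univ, ?_, fun _ _ _ h => h.elim⟩
      have : n = 1 := by omega
      simp [this]
  | succ k ih =>
    rcases Nat.lt_or_ge n 2 with h | h
    · rcases Nat.eq_zero_or_pos n with rfl | h0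
      · exact ⟨∅, rfl, fun v hv => absurd hv (Finset.notMem_empty v)⟩
      · refine ⟨gridBox (k + 1) 1 0, ?_, isInitialSegmentN_gridBox _ _ _⟩
        rw [card_gridBox _ _ _ (Nat.zero_le _), boxCard_zero_right, one_pow]
        omega
    · obtain ⟨r, j, t, hr, hj, ht, htb, rfl⟩ := exists_eq_boxCard_add k n h
      obtain ⟨S, hSc, hS⟩ := ih t (by
        rcases Nat.eq_zero_or_pos k with rfl | hk
        · left
          simpa [Nat.le_zero.1 hj, boxCard] using htb
        · exact Or.inr hk)
      have hSb : S ⊆ gridBox k r j :=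
        hS.subset_of_card_le (isInitialSegmentN_gridBox k r j)
          (by rwa [card_gridBox k r j hj, hSc])
      refine ⟨_, ?_, isInitialSegmentN_gridBox_union_layer hj hS hSb⟩
      rw [Finset.card_union_of_disjoint (disjoint_gridBox_layer hj S),
        card_gridBox _ _ _ (by omega), card_layer, hSc]

/-! ### Projection sums and layers -/

/-- The vector `y` with the coordinates in `I` replaced by `0`. -/
def zeroOut {k : ℕ} (I : Finset (Fin k)) (y : Fin k → ℕ) : Fin k → ℕ :=
  fun i => if i ∈ I then 0 else y i

theorem card_deleteCoords {k : ℕ} (I : Finset (Fin k)) (Y : Finset (Fin k → ℕ)) :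
    (deleteCoords I Y).card = (Y.image (zeroOut I)).card := by
  let e : ({i : Fin k // i ∉ I} → ℕ) → Fin k → ℕ :=
    fun z i => if h : i ∈ I then 0 else z ⟨i, h⟩
  have he : Function.Injective e := by
    intro z w h
    ext ⟨i, hi⟩
    simpa [e, hi] using congrFun h i
  rw [← Finset.card_image_of_injective _ he, deleteCoords, Finset.image_image]
  rfl

/-- The sum of the sizes of all coordinate projections, as a natural number. -/
def projCount {k : ℕ} (Y : Finset (Fin k → ℕ)) : ℕ :=
  ∑ I : Finset (Fin k), (Y.image (zeroOut I)).card

theorem projectionSum_eq {k : ℕ} (Y : Finset (Fin k → ℕ)) :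
    projectionSum Y = (projCount Y : ℝ) := by
  simp only [projectionSum, projCount, card_deleteCoords, Nat.cast_sum]

theorem projCount_empty (k : ℕ) : projCount (∅ : Finset (Fin k → ℕ)) = 0 := by
  simp [projCount]

theorem projCount_of_card_eq_one {k : ℕ} {Y : Finset (Fin k → ℕ)} (h : Y.card = 1) :
    projCount Y = 2 ^ k := by
  obtain ⟨y, rfl⟩ := Finset.card_eq_one.1 h
  simp [projCount]

theorem projCount_union_le {k : ℕ} (Y Z : Finset (Fin k → ℕ)) :
    projCount (Y ∪ Z) ≤ projCount Y + projCount Z := by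
  simp only [projCount, ← Finset.sum_add_distrib, Finset.image_union]
  exact Finset.sum_le_sum fun I _ => Finset.card_union_le _ _

/-- Relabelling the entries does not increase the projection sum. -/
theorem projCount_image_comp_le {k : ℕ} (g : ℕ → ℕ) (Y : Finset (Fin k → ℕ)) :
    projCount (Y.image fun y i => g (y i)) ≤ projCount Y := by
  refine Finset.sum_le_sum fun I _ => ?_
  have h : (Y.image fun y i => g (y i)).image (zeroOut I) =
      (Y.image (zeroOut I)).image fun y i => if i ∈ I then 0 else g (y i) := by
    rw [Finset.image_image, Finset.image_image]
    refine Finset.image_congr fun y _ => funext fun i => ?_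
    by_cases hi : i ∈ I <;> simp [zeroOut, hi]
  rw [h]
  exact Finset.card_image_le

theorem sum_finset_fin_succ {k : ℕ} (i : Fin (k + 1)) (F : Finset (Fin (k + 1)) → ℕ) :
    ∑ I, F I = ∑ J : Finset (Fin k), F (insert i (J.map i.succAboveEmb)) +
      ∑ J : Finset (Fin k), F (J.map i.succAboveEmb) := by
  have hi : ∀ J : Finset (Fin k), i ∉ J.map i.succAboveEmb := by
    intro J h
    obtain ⟨l, -, hl⟩ := Finset.mem_map.1 h
    exact Fin.succAbove_ne i l hl
  have hpre : ∀ I : Finset (Fin (k + 1)), i ∉ I →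
      (Finset.univ.filter fun l => i.succAbove l ∈ I).map i.succAboveEmb = I := by
    intro I hI
    ext l
    simp only [Finset.mem_map, Finset.mem_filter, Finset.mem_univ, true_and,
      Fin.succAboveEmb_apply]
    constructor
    · rintro ⟨a, ha, rfl⟩
      exact ha
    · intro hl
      obtain ⟨a, rfl⟩ := Fin.exists_succAbove_eq (ne_of_mem_of_not_mem hl hI)
      exact ⟨a, hl, rfl⟩
  have hinj : Function.Injective fun J : Finset (Fin k) => J.map i.succAboveEmb :=
    Finset.map_injective _
  rw [← Finset.sum_filter_add_sum_filter_not Finset.univ (fun I => i ∈ I)]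
  congr 1
  · symm
    refine Finset.sum_bij (fun J _ => insert i (J.map i.succAboveEmb)) (by simp) ?_ ?_
      (fun _ _ => rfl)
    · intro J _ K _ h
      have := congrArg (fun I => I.erase i) h
      simp only [Finset.erase_insert (hi _)] at this
      exact hinj this
    · intro I hI
      have hI : i ∈ I := (Finset.mem_filter.1 hI).2
      exact ⟨_, Finset.mem_univ _, by
        rw [hpre (I.erase i) (Finset.notMem_erase i I), Finset.insert_erase hI]⟩
  · symm
    refine Finset.sum_bij (fun J _ => J.map i.succAboveEmb) (fun J _ => by simp [hi J]) ?_ ?_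
      (fun _ _ => rfl)
    · intro J _ K _ h
      exact hinj h
    · intro I hI
      exact ⟨_, Finset.mem_univ _, hpre I (Finset.mem_filter.1 hI).2⟩

theorem zeroOut_map_insertNth {k : ℕ} (i : Fin (k + 1)) (J : Finset (Fin k)) (c : ℕ)
    (y : Fin k → ℕ) :
    zeroOut (J.map i.succAboveEmb) (i.insertNth (α := fun _ => ℕ) c y) =
      i.insertNth (α := fun _ => ℕ) c (zeroOut J y) := by
  rw [Fin.eq_insertNth_iff]
  constructor
  · simp [zeroOut, Fin.succAbove_ne]
  · funext l
    simp [zeroOut, Fin.removeNth]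

theorem image_zeroOut_layer {k : ℕ} (i : Fin (k + 1)) (J : Finset (Fin k)) (c : ℕ)
    (L : Finset (Fin k → ℕ)) :
    (layer i c L).image (zeroOut (J.map i.succAboveEmb)) = layer i c (L.image (zeroOut J)) := by
  simp only [layer, Finset.image_image]
  exact Finset.image_congr fun y _ => zeroOut_map_insertNth i J c y

theorem card_image_zeroOut_union_layer {k : ℕ} {i : Fin (k + 1)} {c : ℕ}
    {Z : Finset (Fin (k + 1) → ℕ)} (hZ : ∀ z ∈ Z, z i ≠ c) (J : Finset (Fin k))
    (L : Finset (Fin k → ℕ)) :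
    ((Z ∪ layer i c L).image (zeroOut (J.map i.succAboveEmb))).card =
      (Z.image (zeroOut (J.map i.succAboveEmb))).card + (L.image (zeroOut J)).card := by
  rw [Finset.image_union, image_zeroOut_layer, Finset.card_union_of_disjoint, card_layer]
  refine Finset.disjoint_left.2 fun u hu hl => ?_
  obtain ⟨z, hz, rfl⟩ := Finset.mem_image.1 hu
  have h1 := (mem_layer.1 hl).1
  simp only [zeroOut, Finset.mem_map, Fin.succAboveEmb_apply, Fin.succAbove_ne, and_false,
    exists_false, if_false] at h1
  exact hZ z hz h1

/-- Projections keeping coordinate `i` separate the layer from `Z`, so their sizes add; the others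
are at least those of `Z`. -/
theorem le_projCount_union_layer {k : ℕ} {i : Fin (k + 1)} {c : ℕ}
    {Z : Finset (Fin (k + 1) → ℕ)} (hZ : ∀ z ∈ Z, z i ≠ c) (L : Finset (Fin k → ℕ)) :
    projCount Z + projCount L ≤ projCount (Z ∪ layer i c L) := by
  have h1 : ∀ J : Finset (Fin k), (Z.image (zeroOut (insert i (J.map i.succAboveEmb)))).card ≤
      ((Z ∪ layer i c L).image (zeroOut (insert i (J.map i.succAboveEmb)))).card := fun J =>
    Finset.card_le_card (Finset.image_subset_image Finset.subset_union_left)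
  have h2 := Finset.sum_le_sum fun J (_ : J ∈ (Finset.univ : Finset (Finset (Fin k)))) => h1 J
  simp only [projCount, sum_finset_fin_succ i, card_image_zeroOut_union_layer hZ,
    Finset.sum_add_distrib]
  omega

/-- Equality holds because projections deleting `i` gain nothing: each point of the layer lies over
a point of `Z`. -/
theorem projCount_union_layer {k : ℕ} {i : Fin (k + 1)} {c : ℕ}
    {Z : Finset (Fin (k + 1) → ℕ)} (hZ : ∀ z ∈ Z, z i ≠ c) (L : Finset (Fin k → ℕ))
    (hL : ∀ y ∈ L, ∃ b, i.insertNth (α := fun _ => ℕ) b y ∈ Z) :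
    projCount (Z ∪ layer i c L) = projCount Z + projCount L := by
  have h1 : ∀ J : Finset (Fin k),
      (Z ∪ layer i c L).image (zeroOut (insert i (J.map i.succAboveEmb))) =
        Z.image (zeroOut (insert i (J.map i.succAboveEmb))) := by
    intro J
    rw [Finset.image_union, Finset.union_eq_left]
    intro u hu
    obtain ⟨w, hw, rfl⟩ := Finset.mem_image.1 hu
    obtain ⟨y, hy, rfl⟩ := Finset.mem_image.1 hw
    obtain ⟨b, hb⟩ := hL y hy
    refine Finset.mem_image.2 ⟨_, hb, funext fun l => ?_⟩
    by_cases hl : l = i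
    · simp [zeroOut, hl]
    · obtain ⟨a, rfl⟩ := Fin.exists_succAbove_eq hl
      simp [zeroOut]
  simp only [projCount, sum_finset_fin_succ i, card_image_zeroOut_union_layer hZ,
    Finset.sum_add_distrib, h1]
  omega

/-! ### The recursion for initial segments -/

open Classical in
/-- The projection sum of an initial segment of size `n`, and `0` if there is none. -/
noncomputable def segmentCount (k n : ℕ) : ℕ :=
  if h : ∃ S : Finset (Fin k → ℕ), S.card = n ∧ IsInitialSegmentN S then projCount h.choose else 0

theorem segmentCount_eq {k : ℕ} {S : Finset (Fin k → ℕ)} (hS : IsInitialSegmentN S) :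
    segmentCount k S.card = projCount S := by
  have h : ∃ T : Finset (Fin k → ℕ), T.card = S.card ∧ IsInitialSegmentN T := ⟨S, rfl, hS⟩
  rw [segmentCount, dif_pos h, h.choose_spec.2.eq_of_card_eq hS h.choose_spec.1]

theorem layerRecursion_segmentCount : LayerRecursion segmentCount where
  zero k := by
    obtain ⟨S, hc, hS⟩ := exists_isInitialSegmentN k 0 (Or.inl (by norm_num))
    have h := segmentCount_eq hS
    rwa [hc, Finset.card_eq_zero.1 hc, projCount_empty] at h
  one k := by
    obtain ⟨S, hc, hS⟩ := exists_isInitialSegmentN k 1 (Or.inl le_rfl)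
    rw [← hc, segmentCount_eq hS, projCount_of_card_eq_one hc]
  layer k r j t hr hj ht := by
    obtain ⟨S, rfl, hS⟩ := exists_isInitialSegmentN k t (by
      rcases Nat.eq_zero_or_pos k with rfl | hk
      · left
        simpa [Nat.le_zero.1 hj, boxCard] using ht
      · exact Or.inr hk)
    have hSb : S ⊆ gridBox k r j :=
      hS.subset_of_card_le (isInitialSegmentN_gridBox k r j) (by rwa [card_gridBox k r j hj])
    have hB := card_gridBox (k + 1) r j (by omega)
    rw [← hB, segmentCount_eq (isInitialSegmentN_gridBox _ _ _), segmentCount_eq hS,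
      ← card_layer (growCoord k j) r S,
      ← Finset.card_union_of_disjoint (disjoint_gridBox_layer hj S),
      segmentCount_eq (isInitialSegmentN_gridBox_union_layer hj hS hSb)]
    refine projCount_union_layer (fun z hz => (gridBox_growCoord_lt hj hz).ne) S fun y hy => ?_
    -- Height `0` is available in the box since `r ≥ 1`.
    refine ⟨0, mem_gridBox.2 fun l => ?_⟩
    by_cases hl : l = growCoord k j
    · subst hl
      simp only [Fin.insertNth_apply_same]
      omega
    · have h := removeNth_le_and_lt (u := (growCoord k j).insertNth (α := fun _ => ℕ) r y)
        (by rw [Fin.removeNth_insertNth]; exact hSb hy) l hl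
      obtain ⟨a, rfl⟩ := Fin.exists_succAbove_eq hl
      simp only [Fin.insertNth_apply_succAbove] at h ⊢
      refine ⟨h.1, fun hlt => ?_⟩
      rcases Nat.lt_or_ge ((growCoord k j).succAbove a : ℕ) (k - j) with h1 | h1
      · exact h.2 h1
      · exact absurd (Fin.ext (by simp only [growCoord] at h1 hlt ⊢; omega)) hl

/-! ### Minimality by induction on the dimension -/

/-- Initial segments minimise the projection sum in dimension `k`. -/
def SegmentsMinimal (k : ℕ) : Prop :=
  ∀ Y : Finset (Fin k → ℕ), segmentCount k Y.card ≤ projCount Y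

theorem segmentsMinimal_zero : SegmentsMinimal 0 := fun Y =>
  (segmentCount_eq (S := Y) fun _ _ _ h => False.elim h).le

theorem segmentCount_zero_of_two_le {n : ℕ} (hn : 2 ≤ n) : segmentCount 0 n = 0 := by
  rw [segmentCount, dif_neg]
  rintro ⟨S, rfl, -⟩
  have := Finset.card_le_one_of_subsingleton S
  omega

/-- Two segments relabelled with even and odd entries are disjoint; their union competes with the
segment of size `a + b`. In dimension `0` the default value `0` for sizes above `1` keeps the bound
true. -/
theorem SegmentsMinimal.segmentCount_add_le {k : ℕ} (h : SegmentsMinimal k) (a b : ℕ) :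
    segmentCount k (a + b) ≤ segmentCount k a + segmentCount k b := by
  rcases Nat.eq_zero_or_pos k with rfl | hk
  · rcases Nat.eq_zero_or_pos a with rfl | ha
    · simp
    rcases Nat.eq_zero_or_pos b with rfl | hb
    · simp
    rw [segmentCount_zero_of_two_le (by omega)]
    exact Nat.zero_le _
  obtain ⟨S, rfl, hS⟩ := exists_isInitialSegmentN k a (Or.inr hk)
  obtain ⟨T, rfl, hT⟩ := exists_isInitialSegmentN k b (Or.inr hk)
  have hinj : ∀ c : ℕ, Function.Injective fun (y : Fin k → ℕ) i => 2 * y i + c := by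
    intro c y z hyz
    funext i
    have := congrFun hyz i
    simp only at this
    omega
  let S' := S.image fun y i => 2 * y i + 0
  let T' := T.image fun y i => 2 * y i + 1
  have hd : Disjoint S' T' := by
    refine Finset.disjoint_left.2 fun u hu hv => ?_
    obtain ⟨y, -, rfl⟩ := Finset.mem_image.1 hu
    obtain ⟨z, -, hz⟩ := Finset.mem_image.1 hv
    have : 2 * z ⟨0, hk⟩ + 1 = 2 * y ⟨0, hk⟩ + 0 := congrFun hz ⟨0, hk⟩
    omega
  have hc : (S' ∪ T').card = S.card + T.card := by
    rw [Finset.card_union_of_disjoint hd, Finset.card_image_of_injective _ (hinj 0),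
      Finset.card_image_of_injective _ (hinj 1)]
  rw [segmentCount_eq hS, segmentCount_eq hT, ← hc]
  exact (h _).trans ((projCount_union_le S' T').trans
    (add_le_add (projCount_image_comp_le (fun x => 2 * x + 0) S)
      (projCount_image_comp_le (fun x => 2 * x + 1) T)))

/-- In some direction a finite set has a layer of at most average size, the number of layers
being at least the side of a cube which contains as many points. -/
theorem exists_small_layer {k : ℕ} (Y : Finset (Fin (k + 1) → ℕ)) (hY : Y.Nonempty) :
    ∃ i c s, Y.card ≤ s ^ (k + 1) ∧ (Y.filter fun y => y i = c).Nonempty ∧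
      (Y.filter fun y => y i = c).card * s ≤ Y.card := by
  obtain ⟨i, -, hi⟩ := Finset.exists_max_image Finset.univ
    (fun i => (Y.image fun y => y i).card) Finset.univ_nonempty
  let A := Y.image fun y => y i
  have hA : A.Nonempty := hY.image _
  have hpos : 0 < A.card := hA.card_pos
  have hcard : Y.card ≤ A.card ^ (k + 1) := by
    have hsub : Y ⊆ Fintype.piFinset fun i => Y.image fun y => y i := fun y hy =>
      Fintype.mem_piFinset.2 fun i => Finset.mem_image_of_mem _ hy
    refine (Finset.card_le_card hsub).trans ?_
    rw [Fintype.card_piFinset]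
    refine (Finset.prod_le_pow_card _ _ A.card fun j _ => hi j (Finset.mem_univ j)).trans ?_
    simp
  obtain ⟨c, hc, hmin⟩ := Finset.exists_min_image A
    (fun c => (Y.filter fun y => y i = c).card) hA
  refine ⟨i, c, A.card, hcard, ?_, ?_⟩
  · obtain ⟨y, hy, hyc⟩ := Finset.mem_image.1 hc
    exact ⟨y, Finset.mem_filter.2 ⟨hy, hyc⟩⟩
  · rw [Finset.card_eq_sum_card_image (fun y => y i) Y, mul_comm, ← smul_eq_mul]
    exact Finset.card_nsmul_le_sum _ _ _ hmin

theorem segmentsMinimal_succ {k : ℕ} (h : SegmentsMinimal k)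
    (hK : LayerRecursion.RemovesLayer segmentCount k) : SegmentsMinimal (k + 1) := by
  intro Y
  induction hn : Y.card using Nat.strong_induction_on generalizing Y with
  | _ n ih =>
    subst hn
    rcases Nat.lt_or_ge Y.card 2 with hlt | hge
    · rcases Nat.eq_zero_or_pos Y.card with h0 | h0
      · rw [h0, layerRecursion_segmentCount.zero]
        exact Nat.zero_le _
      · have h1 : Y.card = 1 := by omega
        rw [projCount_of_card_eq_one h1, h1, layerRecursion_segmentCount.one]
    obtain ⟨i, c, s, hs, hne, hm⟩ := exists_small_layer Y (Finset.card_pos.1 (by omega))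
    have hpos := hne.card_pos
    let Z := Y.filter fun y => y i ≠ c
    let L := (Y.filter fun y => y i = c).image i.removeNth
    have hinj : Set.InjOn (i.removeNth (α := fun _ => ℕ))
        (Y.filter fun y => y i = c : Finset (Fin (k + 1) → ℕ)) := by
      intro u hu v hv huv
      have hu := (Finset.mem_filter.1 hu).2
      have hv := (Finset.mem_filter.1 hv).2
      rw [← Fin.insertNth_self_removeNth i u, ← Fin.insertNth_self_removeNth i v, huv, hu, hv]
    have hLc : L.card = (Y.filter fun y => y i = c).card := Finset.card_image_of_injOn hinj
    have hlayer : layer i c L = Y.filter fun y => y i = c := by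
      ext u
      rw [mem_layer]
      constructor
      · rintro ⟨huc, hu⟩
        obtain ⟨v, hv, hvu⟩ := Finset.mem_image.1 hu
        have hvc := (Finset.mem_filter.1 hv).2
        rw [← Fin.insertNth_self_removeNth i u, ← hvu, huc, ← hvc,
          Fin.insertNth_self_removeNth]
        exact hvc ▸ hv
      · intro hu
        exact ⟨(Finset.mem_filter.1 hu).2, Finset.mem_image_of_mem _ hu⟩
    have hYZ : Z ∪ layer i c L = Y := by
      rw [hlayer, Finset.union_comm]
      exact Finset.filter_union_filter_not_eq _ Y
    have hsum : (Y.filter fun y => y i = c).card + Z.card = Y.card :=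
      Finset.card_filter_add_card_filter_not _
    have h1 := hK Y.card s _ hge hs hm
    have h2 := ih Z.card (by omega) Z rfl
    have h3 := h L
    have hZ : ∀ z ∈ Z, z i ≠ c := fun z hz => (Finset.mem_filter.1 hz).2
    have h4 := le_projCount_union_layer hZ L
    rw [hYZ] at h4
    rw [hLc] at h3
    rw [show Y.card - (Y.filter fun y => y i = c).card = Z.card by omega] at h1
    omega

theorem segmentsMinimal (k : ℕ) : SegmentsMinimal k := by
  -- The three statements feed each other; `RemovesLayer` lags one dimension because its proof in
  -- dimension `k + 1` uses minimality in dimension `k`.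
  suffices h : SegmentsMinimal k ∧ LayerRecursion.BoxConcave segmentCount k ∧
      ∀ l, k = l + 1 → LayerRecursion.RemovesLayer segmentCount l from h.1
  induction k with
  | zero =>
    exact ⟨segmentsMinimal_zero, LayerRecursion.boxConcave_zero _,
      fun l hl => absurd hl (Nat.succ_ne_zero l).symm⟩
  | succ k ih =>
    obtain ⟨hm, hE, hK⟩ := ih
    have hs := hm.segmentCount_add_le
    have hK' := layerRecursion_segmentCount.removesLayer k hs hE hK
    refine ⟨segmentsMinimal_succ hm hK', layerRecursion_segmentCount.boxConcave_succ k hs hE, ?_⟩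
    intro l hl
    exact Nat.succ_injective hl ▸ hK'

theorem mainTheorem6 (k : ℕ) (hk : 1 ≤ k) (n : ℕ) :
    (∃! S : Finset (Fin k → ℕ), S.card = n ∧ IsInitialSegmentN S) ∧
    ∀ S : Finset (Fin k → ℕ), S.card = n → IsInitialSegmentN S →
      IsMinOn projectionSum {Y : Finset (Fin k → ℕ) | Y.card = n} S := by
  constructor
  · obtain ⟨S, hSc, hS⟩ := exists_isInitialSegmentN k n (Or.inr hk)
    exact ⟨S, ⟨hSc, hS⟩, fun T hT => hT.2.eq_of_card_eq hS (hT.1.trans hSc.symm)⟩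
  · rintro S rfl hS Y hY
    have h := segmentsMinimal k Y
    rw [show Y.card = S.card from hY, segmentCount_eq hS] at h
    change projectionSum S ≤ projectionSum Y
    rw [projectionSum_eq, projectionSum_eq]
    exact_mod_cast h
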